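/- Let $B_n$ be Artin's braid group on $n$ strands and let $P_n\subset B_n$ be the pure braid group. For $0\le i\le n$ let $d_i\colon P_{n+1}\to P_n$ be the homomorphism that deletes the $(i+1)$-st strand, and put $$\mathrm{Brun}_{n+1}=\bigcap_{0\le i\le n}\ker(d_i\colon P_{n+1}\to P_n),\qquad \mathrm{QBrun}_{n+1}=\bigcap_{1\le i\le n}\ker(d_i\colon P_{n+1}\to P_n).$$ Let $F_n=F[y_1,\dots,y_n]$ be the free group and let $\Theta_n\colon F_n\to P_{n+1}$ be the homomorphism that sends $y_q$ to the braid obtained from the generator $A_{1,2}=\sigma_1^2$ of $P_2$ by replacing its first strand by $n+1-q$ parallel strands and its second strand by $q$ parallel strands. Let $F[S^1]_\bullet$ be Milnor's free simplicial group on the simplicial circle, so that $F[S^1]_n=F_n$, and for $0\le j\le n+1$ the face $d_j\colon F_{n+1}\to F_n$ sends $y_q$ to $y_q$ if $j\le n+1-q$ and to $y_{q-1}$ otherwise, where $y_0=y_{n+1}=1$ in $F_n$. Its cycles and boundaries are, for $n\ge 1$, $$Z_n=\bigcap_{0\le j\le n}\ker(d_j\colon F_n\to F_{n-1}),\qquad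 B_n(F[S^1])=d_0\Bigl(\bigcap_{1\le j\le n+1}\ker(d_j\colon F_{n+1}\to F_n)\Bigr).$$ Then for every $k\ge 3$: 1. each of the groups $\Theta_k(F_k)\cap\mathrm{Brun}_{k+1}$, $\Theta_k(F_k)\cap d_0(\mathrm{QBrun}_{k+2})$ and $d_0\bigl(\Theta_{k+1}(F_{k+1})\cap\mathrm{QBrun}_{k+2}\bigr)$ is a free group of countably infinite rank; 2. $\Theta_k$ is injective, and it identifies the cycles and the boundaries of $F[S^1]_\bullet$ in degree $k$ with subgroups of $P_{k+1}$ as follows: $\Theta_k(Z_k)=\Theta_k(F_k)\cap\mathrm{Brun}_{k+1}$ and $\Theta_k(B_k(F[S^1]))=d_0\bigl(\Theta_{k+1}(F_{k+1})\cap\mathrm{QBrun}_{k+2}\bigr)$. -/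

import Mathlib

namespace BraidCabling

/-! ## Artin's braid group and the pure braid group -/

/-- Artin's relations on the generators `σ_0, …, σ_{n-2}` for braids with `n` strands:
`σ_i σ_{i+1} σ_i = σ_{i+1} σ_i σ_{i+1}`, and `σ_i σ_j = σ_j σ_i` for `|i - j| ≥ 2`. -/
def braidRels (n : ℕ) : Set (FreeGroup (Fin (n - 1))) :=
  {r | ∃ i j : Fin (n - 1), i.val + 1 = j.val ∧
      r = (FreeGroup.of i * FreeGroup.of j * FreeGroup.of i) *
        (FreeGroup.of j * FreeGroup.of i * FreeGroup.of j)⁻¹} ∪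
  {r | ∃ i j : Fin (n - 1), i.val + 2 ≤ j.val ∧
      r = (FreeGroup.of i * FreeGroup.of j) * (FreeGroup.of j * FreeGroup.of i)⁻¹}

/-- Artin's braid group `B_n` on `n` strands. Positions of strands are numbered `0, …, n - 1`, a
braid word is read from left to right (the leftmost letter is the first crossing), and `σ_i` is
the crossing of the strands that are in the positions `i` and `i + 1`. -/
abbrev BraidGroup (n : ℕ) : Type := PresentedGroup (braidRels n)

/-- The generator `σ_i` of `B_n`, for `i + 1 < n` (and `1` for the other, unused values of `i`). -/
def sigma (n i : ℕ) : BraidGroup n :=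
  if h : i < n - 1 then PresentedGroup.of ⟨i, h⟩ else 1

/-- The transposition of the positions `i` and `i + 1`, for `i + 1 < n`. -/
def adjSwap (n : ℕ) (i : Fin (n - 1)) : Equiv.Perm (Fin n) :=
  Equiv.swap ⟨i.val, by omega⟩ ⟨i.val + 1, by omega⟩

/-- A homomorphism to `H` is determined by images of the `σ_i` that satisfy Artin's relations. -/
def braidLift {n : ℕ} {H : Type*} [Group H] (f : Fin (n - 1) → H)
    (hbraid : ∀ i j : Fin (n - 1), i.val + 1 = j.val → f i * f j * f i = f j * f i * f j)
    (hcomm : ∀ i j : Fin (n - 1), i.val + 2 ≤ j.val → f i * f j = f j * f i) :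
    BraidGroup n →* H :=
  PresentedGroup.toGroup (f := f) (by
    rintro r (⟨i, j, hij, rfl⟩ | ⟨i, j, hij, rfl⟩)
    · simp only [map_mul, map_inv, FreeGroup.lift_apply_of]
      rw [hbraid i j hij, mul_inv_cancel]
    · simp only [map_mul, map_inv, FreeGroup.lift_apply_of]
      rw [hcomm i j hij, mul_inv_cancel])

@[simp] theorem braidLift_of {n : ℕ} {H : Type*} [Group H] (f : Fin (n - 1) → H)
    (hbraid : ∀ i j : Fin (n - 1), i.val + 1 = j.val → f i * f j * f i = f j * f i * f j)
    (hcomm : ∀ i j : Fin (n - 1), i.val + 2 ≤ j.val → f i * f j = f j * f i) (i : Fin (n - 1)) :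
    braidLift f hbraid hcomm (PresentedGroup.of i) = f i :=
  PresentedGroup.toGroup.of _

theorem adjSwap_val (n : ℕ) (i : Fin (n - 1)) (p : Fin n) :
    (adjSwap n i p).val =
      if p.val = i.val then i.val + 1 else if p.val = i.val + 1 then i.val else p.val := by
  simp only [adjSwap, Equiv.swap_apply_def, Fin.ext_iff]
  split_ifs <;> rfl

theorem adjSwap_inv (n : ℕ) (i : Fin (n - 1)) : (adjSwap n i)⁻¹ = adjSwap n i :=
  Equiv.swap_inv _ _

theorem adjSwap_braid (n : ℕ) (i j : Fin (n - 1)) (hij : i.val + 1 = j.val) :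
    adjSwap n i * adjSwap n j * adjSwap n i = adjSwap n j * adjSwap n i * adjSwap n j := by
  apply Equiv.ext
  intro x
  apply Fin.ext
  simp only [Equiv.Perm.mul_apply, adjSwap_val]
  grind

theorem adjSwap_comm (n : ℕ) (i j : Fin (n - 1)) (hij : i.val + 2 ≤ j.val) :
    adjSwap n i * adjSwap n j = adjSwap n j * adjSwap n i := by
  apply Equiv.ext
  intro x
  apply Fin.ext
  simp only [Equiv.Perm.mul_apply, adjSwap_val]
  grind

/-- The homomorphism `B_n → Σ_n` with `σ_i ↦ (i, i + 1)`. Since words are read from left to right,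
the strand of the braid `b` that starts in position `p` ends in position `(braidPerm n b)⁻¹ p`. -/
def braidPerm (n : ℕ) : BraidGroup n →* Equiv.Perm (Fin n) :=
  braidLift (adjSwap n) (adjSwap_braid n) (adjSwap_comm n)

/-- The pure braid group `P_n`: the braids with trivial permutation of the endpoints. -/
def PureBraid (n : ℕ) : Subgroup (BraidGroup n) := (braidPerm n).ker

/-! ## Deletion of a strand -/

/-- What is left of the crossing `σ_i` of `n + 1` strands when the strand that enters it in
position `p` is deleted: nothing if that strand takes part in the crossing, `σ_{i-1}` if it passes
to the left of the crossing, and `σ_i` if it passes to the right. -/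
def deleteGen (n : ℕ) (i : Fin n) (p : Fin (n + 1)) : BraidGroup n :=
  if p.val < i.val then sigma n (i.val - 1)
  else if p.val ≤ i.val + 1 then 1
  else sigma n i.val

/-- `(Fin m → G) ⋊ Σ_m` with multiplication
`(u, s) (v, t) = (p ↦ u p * v (s⁻¹ p), s t)`. -/
abbrev Wreath (m : ℕ) (G : Type) [Group G] : Type :=
  (Fin m → G) ⋊[(mulAutArrow : Equiv.Perm (Fin m) →* MulAut (Fin m → G))] Equiv.Perm (Fin m)

theorem wreath_mul_left {m : ℕ} {G : Type} [Group G] (a b : Wreath m G) (p : Fin m) :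
    (a * b).left p = a.left p * b.left (a.right⁻¹ p) := rfl

theorem wreath_mul_right {m : ℕ} {G : Type} [Group G] (a b : Wreath m G) :
    (a * b).right = a.right * b.right := rfl

theorem sigma_braid (n i : ℕ) (h : i + 2 < n) :
    sigma n i * sigma n (i + 1) * sigma n i = sigma n (i + 1) * sigma n i * sigma n (i + 1) := by
  have h1 : i < n - 1 := by omega
  have h2 : i + 1 < n - 1 := by omega
  simp only [sigma, h1, h2, dif_pos]
  rw [← mul_inv_eq_one]
  exact PresentedGroup.one_of_mem (rels := braidRels n) (Or.inl ⟨⟨i, h1⟩, ⟨i + 1, h2⟩, rfl, rfl⟩)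

theorem sigma_comm (n i j : ℕ) (hij : i + 2 ≤ j) :
    sigma n i * sigma n j = sigma n j * sigma n i := by
  by_cases h2 : j < n - 1
  · have h1 : i < n - 1 := by omega
    simp only [sigma, h1, h2, dif_pos]
    rw [← mul_inv_eq_one]
    exact PresentedGroup.one_of_mem (rels := braidRels n) (Or.inr ⟨⟨i, h1⟩, ⟨j, h2⟩, hij, rfl⟩)
  · simp [sigma, h2]

/-- The image of `σ_i` under simultaneous deletion of each of the strands, together with its
permutation. -/
def deleteGenWreath (n : ℕ) (i : Fin (n + 1 - 1)) : Wreath (n + 1) (BraidGroup n) :=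
  ⟨deleteGen n i, adjSwap (n + 1) i⟩

theorem deleteGenWreath_braid (n : ℕ) (i j : Fin (n + 1 - 1)) (hij : i.val + 1 = j.val) :
    deleteGenWreath n i * deleteGenWreath n j * deleteGenWreath n i =
      deleteGenWreath n j * deleteGenWreath n i * deleteGenWreath n j := by
  apply SemidirectProduct.ext
  · funext p
    simp only [deleteGenWreath, wreath_mul_left, wreath_mul_right, mul_inv_rev, adjSwap_inv,
      Equiv.Perm.mul_apply, deleteGen, adjSwap_val]
    have hj := j.isLt
    obtain h | h | h | h | h : p.val < i.val ∨ p.val = i.val ∨ p.val = i.val + 1 ∨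
        p.val = i.val + 2 ∨ i.val + 2 < p.val := by omega
    · have hb := sigma_braid n (i.val - 1) (by omega)
      rw [show i.val - 1 + 1 = i.val by omega] at hb
      grind
    · grind (splits := 20)
    · grind (splits := 20)
    · grind (splits := 20)
    · have hb := sigma_braid n i.val (by omega)
      grind
  · exact adjSwap_braid (n + 1) i j hij

theorem deleteGenWreath_comm (n : ℕ) (i j : Fin (n + 1 - 1)) (hij : i.val + 2 ≤ j.val) :
    deleteGenWreath n i * deleteGenWreath n j = deleteGenWreath n j * deleteGenWreath n i := by
  apply SemidirectProduct.ext
  · funext p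
    simp only [deleteGenWreath, wreath_mul_left, adjSwap_inv, deleteGen, adjSwap_val]
    obtain h | h | h | h | h : p.val < i.val ∨ (p.val = i.val ∨ p.val = i.val + 1) ∨
        (i.val + 1 < p.val ∧ p.val < j.val) ∨
        (p.val = j.val ∨ p.val = j.val + 1) ∨ j.val + 1 < p.val := by omega
    · have hb := sigma_comm n (i.val - 1) (j.val - 1) (by omega)
      grind
    · grind
    · have hb := sigma_comm n i.val (j.val - 1)
      grind
    · grind
    · have hb := sigma_comm n i.val j.val hij
      grind
  · exact adjSwap_comm (n + 1) i j hij

/-- Deletion of each of the strands of a braid: the `p`-th entry of the left component of the value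
at `b` is the braid obtained from `b` by deleting the strand that starts in position `p`, and the
right component is the permutation of `b`. -/
def deleteStrands (n : ℕ) : BraidGroup (n + 1) →* Wreath (n + 1) (BraidGroup n) :=
  braidLift (deleteGenWreath n) (deleteGenWreath_braid n) (deleteGenWreath_comm n)

/-- The braid obtained from `b` by deleting the strand that starts in position `p`. -/
def deleteStrand (n : ℕ) (p : Fin (n + 1)) (b : BraidGroup (n + 1)) : BraidGroup n :=
  (deleteStrands n b).left p

theorem deleteStrands_right (n : ℕ) (b : BraidGroup (n + 1)) :
    (deleteStrands n b).right = braidPerm (n + 1) b := by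
  have h : SemidirectProduct.rightHom.comp (deleteStrands n) = braidPerm (n + 1) := by
    apply PresentedGroup.ext
    intro i
    change (deleteStrands n (PresentedGroup.of i)).right = braidPerm (n + 1) (PresentedGroup.of i)
    rw [deleteStrands, braidPerm, braidLift_of, braidLift_of]
    rfl
  exact DFunLike.congr_fun h b

/-- A crossing of the deleted strand contributes nothing, and the position of the deleted strand
is followed along the braid. -/
theorem deleteStrand_mul (n : ℕ) (p : Fin (n + 1)) (a b : BraidGroup (n + 1)) :
    deleteStrand n p (a * b) =
      deleteStrand n p a * deleteStrand n ((braidPerm (n + 1) a)⁻¹ p) b := by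
  rw [← deleteStrands_right]
  simp only [deleteStrand, map_mul, SemidirectProduct.mul_left]
  rfl

theorem deleteStrand_of (n : ℕ) (p : Fin (n + 1)) (i : Fin (n + 1 - 1)) :
    deleteStrand n p (PresentedGroup.of i) = deleteGen n i p := by
  rw [deleteStrand, deleteStrands, braidLift_of]
  rfl

/-- The remaining strands of `b` end where they did before the deletion, up to renumbering. -/
theorem deleteStrand_perm (n : ℕ) (b : BraidGroup (n + 1)) (p : Fin (n + 1)) (j : Fin n) :
    (braidPerm (n + 1) b)⁻¹ (p.succAbove j) =
      ((braidPerm (n + 1) b)⁻¹ p).succAbove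
        ((braidPerm n (deleteStrand n p b))⁻¹ j) := by
  have hone : ∀ q, deleteStrand n q 1 = 1 := fun q => by simp [deleteStrand]
  have hgen : ∀ (i : Fin (n + 1 - 1)) (p : Fin (n + 1)) (j : Fin n),
      adjSwap (n + 1) i (p.succAbove j) =
        (adjSwap (n + 1) i p).succAbove ((braidPerm n (deleteGen n i p))⁻¹ j) := by
    intro i p j
    have hp := p.isLt
    have hi := i.isLt
    have hs : ∀ a (ha : a < n - 1), (braidPerm n (sigma n a))⁻¹ = adjSwap n ⟨a, ha⟩ := by
      intro a ha
      rw [sigma, dif_pos ha, braidPerm, braidLift_of, adjSwap_inv]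
    have hv : ∀ (x : Fin (n + 1)) (y : Fin n), (x.succAbove y).val =
        if y.val < x.val then y.val else y.val + 1 := by
      intro x y
      rw [Fin.succAbove]
      simp only [Fin.lt_def, Fin.val_castSucc]
      split_ifs <;> simp
    apply Fin.ext
    rw [hv, adjSwap_val, hv, adjSwap_val]
    obtain h | h | h : p.val < i.val ∨ (i.val ≤ p.val ∧ p.val ≤ i.val + 1) ∨
        i.val + 1 < p.val := by omega
    · have e : deleteGen n i p = sigma n (i.val - 1) := if_pos h
      rw [e, hs _ (by omega), adjSwap_val]
      grind
    · have e : deleteGen n i p = 1 := by rw [deleteGen, if_neg (by omega), if_pos h.2]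
      rw [e, map_one, inv_one, Equiv.Perm.one_apply]
      grind
    · have e : deleteGen n i p = sigma n i.val := by
        rw [deleteGen, if_neg (by omega), if_neg (by omega)]
      rw [e, hs _ (by omega), adjSwap_val]
      grind
  have hof : ∀ i : Fin (n + 1 - 1), (braidPerm (n + 1) (PresentedGroup.of i))⁻¹ =
      adjSwap (n + 1) i := by
    intro i
    rw [braidPerm, braidLift_of, adjSwap_inv]
  induction b using PresentedGroup.induction_on with
  | _ w =>
  induction w using FreeGroup.induction_on generalizing p j with
  | C1 => simp [hone]
  | of i =>
    change (braidPerm (n + 1) (PresentedGroup.of i))⁻¹ _ =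
      Fin.succAbove ((braidPerm (n + 1) (PresentedGroup.of i))⁻¹ p)
        ((braidPerm n (deleteStrand n p (PresentedGroup.of i)))⁻¹ j)
    rw [hof, deleteStrand_of]
    exact hgen i p j
  | inv_of i ih =>
    rw [map_inv]
    generalize PresentedGroup.mk (braidRels (n + 1)) (FreeGroup.of i) = x at ih ⊢
    obtain ⟨q, rfl⟩ := (braidPerm (n + 1) x)⁻¹.surjective p
    have h1 := deleteStrand_mul n q x x⁻¹
    rw [mul_inv_cancel, hone] at h1
    rw [← inv_eq_of_mul_eq_one_right h1.symm, map_inv, map_inv, inv_inv, inv_inv]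
    obtain ⟨j, rfl⟩ := (braidPerm n (deleteStrand n q x))⁻¹.surjective j
    rw [← ih q j]
    simp
  | mul x y hx hy =>
    rw [map_mul, map_mul, deleteStrand_mul, map_mul, mul_inv_rev, mul_inv_rev,
      Equiv.Perm.mul_apply, Equiv.Perm.mul_apply, hx, hy, Equiv.Perm.mul_apply]

theorem deleteStrand_mem (n : ℕ) (p : Fin (n + 1)) (b : BraidGroup (n + 1))
    (hb : b ∈ PureBraid (n + 1)) : deleteStrand n p b ∈ PureBraid n := by
  have hb' : braidPerm (n + 1) b = 1 := hb
  have key := deleteStrand_perm n b p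
  rw [hb'] at key
  change braidPerm n (deleteStrand n p b) = 1
  rw [← inv_eq_one]
  ext j
  have := key j
  simp only [inv_one, Equiv.Perm.one_apply] at this
  exact congrArg Fin.val (Fin.succAbove_right_injective this).symm

/-- The face homomorphism `d_p : P_{n+1} → P_n`, for `0 ≤ p ≤ n`, which deletes the `(p+1)`-st
strand. -/
def face (n : ℕ) (p : Fin (n + 1)) : PureBraid (n + 1) →* PureBraid n where
  toFun b := ⟨deleteStrand n p b.1, deleteStrand_mem n p b.1 b.2⟩
  map_one' := by
    ext
    simp [deleteStrand]
  map_mul' a b := by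
    have ha : braidPerm (n + 1) a.1 = 1 := a.2
    ext
    simp [deleteStrand_mul, ha]

/-- `Brunnian n` is `Brun_{n+1}`, the group of pure braids with `n + 1` strands that become trivial
after deleting any single strand. -/
def Brunnian (n : ℕ) : Subgroup (PureBraid (n + 1)) := ⨅ i : Fin (n + 1), (face n i).ker

/-- `QBrunnian n` is `QBrun_{n+1}`, the group of pure braids with `n + 1` strands that become
trivial after deleting any single strand other than the first one. -/
def QBrunnian (n : ℕ) : Subgroup (PureBraid (n + 1)) := ⨅ i : Fin n, (face n i.succ).ker

/-! ## The cabling homomorphism -/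

/-- The indices of the letters of the positive word that carries a cable formed by the first `p`
strands across a cable formed by the next `q` strands: the strands `p - 1, …, 1, 0` of the first
cable pass one after the other to the right across the second cable. Each strand of the first cable
crosses each strand of the second one once, and there are no other crossings. -/
def cableWord (p q : ℕ) : List ℕ :=
  (List.range p).reverse.flatMap fun a => (List.range q).map fun b => a + b

/-- The braid with `n` strands in which a cable formed by the first `p` strands passes across a
cable formed by the next `q` strands (`p + q = n`), and back by the same crossings in the reverse
order. This is the pure braid `A_{1,2} = σ_0 ^ 2` with its two strands replaced by `p` and `q`
parallel strands. -/
def cableBraid (n p q : ℕ) : BraidGroup n :=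
  ((cableWord p q ++ (cableWord p q).reverse).map (sigma n)).prod

theorem braidPerm_sigma_mul_self (n i : ℕ) :
    braidPerm n (sigma n i) * braidPerm n (sigma n i) = 1 := by
  unfold sigma
  split_ifs
  · simp [braidPerm, adjSwap]
  · simp

theorem cableBraid_mem (n p q : ℕ) : cableBraid n p q ∈ PureBraid n := by
  change braidPerm n _ = 1
  have h : ∀ w : List ℕ, braidPerm n ((w ++ w.reverse).map (sigma n)).prod = 1 := by
    intro w
    induction w with
    | nil => simp
    | cons a w ih =>
      have e : (a :: w ++ (a :: w).reverse).map (sigma n) =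
          [sigma n a] ++ (w ++ w.reverse).map (sigma n) ++ [sigma n a] := by simp
      rw [e, List.prod_append, List.prod_append, map_mul, map_mul, ih]
      simpa using braidPerm_sigma_mul_self n a
  exact h _

/-- The homomorphism `Θ_n : F[y_1, …, y_n] → P_{n+1}`. The generator `y_{q+1}` is the letter
`q : Fin n`; its image is the cabling of `A_{1,2}` in which the first strand is replaced by `n - q`
and the second one by `q + 1` parallel strands. -/
def Theta (n : ℕ) : FreeGroup (Fin n) →* PureBraid (n + 1) :=
  FreeGroup.lift fun q => ⟨cableBraid (n + 1) (n - q.val) (q.val + 1), cableBraid_mem _ _ _⟩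

/-! ## Milnor's free simplicial group on the simplicial circle -/

/-- The element `y_q` of `F[S^1]_n = F[y_1, …, y_n]`, for `1 ≤ q ≤ n`. For `q = 0` and
`q = n + 1` this is the class of the basepoint, hence `1`. -/
def circleGen (n q : ℕ) : FreeGroup (Fin n) :=
  if h : 1 ≤ q ∧ q ≤ n then FreeGroup.of ⟨q - 1, by omega⟩ else 1

/-- The face homomorphism `d_j : F[S^1]_{n+1} → F[S^1]_n`, for `0 ≤ j ≤ n + 1`. The simplicial
circle has in degree `m` the simplices `y_q = ⟨0^{m+1-q}, 1^q⟩` with `0 ≤ q ≤ m + 1`, where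
`y_0 = y_{m+1}` is the basepoint, and `d_j` deletes the `j`-th entry of a sequence (entries are
numbered from `0`). In degree `m = n + 1` this is one of the zeros of `y_q` if `j + q ≤ n + 1`, so
that `d_j y_q = y_q`, and one of the ones otherwise, so that `d_j y_q = y_{q-1}`. -/
def circleFace (n : ℕ) (j : Fin (n + 2)) : FreeGroup (Fin (n + 1)) →* FreeGroup (Fin n) :=
  FreeGroup.lift fun q =>
    if j.val + (q.val + 1) ≤ n + 1 then circleGen n (q.val + 1) else circleGen n q.val

/-- The group of cycles `Z_{n+1} = ⋂_{0 ≤ j ≤ n+1} Ker (d_j)` of `F[S^1]` in degree `n + 1`. -/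
def circleCyclesSucc (n : ℕ) : Subgroup (FreeGroup (Fin (n + 1))) :=
  ⨅ j : Fin (n + 2), (circleFace n j).ker

/-- The group of cycles of `F[S^1]`, which is everything in degree `0`. -/
def circleCycles : (n : ℕ) → Subgroup (FreeGroup (Fin n))
  | 0 => ⊤
  | n + 1 => circleCyclesSucc n

/-- The group of boundaries `B_n = d_0 (⋂_{1 ≤ j ≤ n+1} Ker (d_j : F[S^1]_{n+1} → F[S^1]_n))` of
`F[S^1]` in degree `n`. -/
def circleBoundaries (n : ℕ) : Subgroup (FreeGroup (Fin n)) :=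
  (⨅ j : Fin (n + 1), (circleFace n j.succ).ker).map (circleFace n 0)

/-- A free group of countably infinite rank. -/
def IsFreeOfCountablyInfiniteRank (G : Type) [Group G] : Prop :=
  Nonempty (FreeGroupBasis ℕ G)

end BraidCabling

namespace BraidCabling

/-! ## Artin's action modulo the boundary -/

/-! Injectivity of `Theta` is detected by Artin's action on the free group with `x_1 ⋯ x_{n+1} = 1`.
In the generators `T_j = x_1 ⋯ x_j`, written `circleGen n j` because `T_0 = T_{n+1} = 1` are exactly
its default values, the cabled full twist with a first cable of `p` strands fixes `T_p`, conjugates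
earlier letters by `T_p⁻¹` and later ones by `T_p` (`artinAction_cableBraid`). Such automorphisms
play ping-pong on the sets of reduced words with a given first letter, so for `n ≥ 2` they generate
a free group (`lift_injective_of_conj_letters`).

Deleting a strand of a cable makes the cable thinner, so `Theta` commutes with all faces
(`face_Theta`). With injectivity one degree lower, this turns the Brunnian conditions into kernels
of the faces of `F[S^1]`, which gives the statements on cycles and boundaries.

Each of the three groups is the image of a subgroup `H` that lies between the boundaries and `Ker
d_0`; for the second one this uses `d_0 d_0 = d_0 d_1` on braids. Subgroups of free groups are free,
so it remains to see that `H` is not finitely generated. `Ker d_0` is free on the conjugates of the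
last letter, which the other letters permute by translation. A finitely generated `H` would have
finite support, but the boundaries form a normal subgroup, and translating a nontrivial boundary off
that support is a contradiction (`not_fg_of_le_ker`). A nontrivial boundary is an iterated
commutator, detected in the affine group of `ℚ` (`circleBoundaries_ne_bot`). -/

theorem circleGen_of_lt {n : ℕ} (i : Fin n) : circleGen n (i.val + 1) = FreeGroup.of i := by
  rw [circleGen, dif_pos (by omega)]
  rfl

@[simp] theorem circleGen_zero (n : ℕ) : circleGen n 0 = 1 := by simp [circleGen]

theorem circleGen_of_gt {n q : ℕ} (h : n < q) : circleGen n q = 1 := by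
  rw [circleGen, dif_neg (by omega)]

/-- Replace the entry `i + 1` of a sequence by `t_{i+2} t_{i+1}⁻¹ t_i`. -/
def tupleMove {G : Type*} [Group G] (t : ℕ → G) (i : ℕ) : ℕ → G :=
  Function.update t (i + 1) (t (i + 2) * (t (i + 1))⁻¹ * t i)

/-- The endomorphism of the free group that replaces the generator `i` by `u`. -/
def replaceGen {n : ℕ} (i : Fin n) (u : FreeGroup (Fin n)) :
    FreeGroup (Fin n) →* FreeGroup (Fin n) :=
  FreeGroup.lift (Function.update FreeGroup.of i u)

theorem replaceGen_circleGen {n : ℕ} (i : Fin n) (u : FreeGroup (Fin n)) (j : ℕ) :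
    replaceGen i u (circleGen n j) = if j = i.val + 1 then u else circleGen n j := by
  by_cases h : 1 ≤ j ∧ j ≤ n
  · obtain ⟨j, rfl⟩ := Nat.exists_eq_add_of_le' h.1
    lift j to Fin n using by omega
    rw [circleGen_of_lt, replaceGen, FreeGroup.lift_apply_of]
    simp [Function.update_apply, Fin.ext_iff]
  · have hi := i.isLt
    have hne : j ≠ i.val + 1 := by omega
    rw [if_neg hne, circleGen, dif_neg h, map_one]

theorem hom_ext_circleGen {n : ℕ} {G : Type*} [Group G] {f g : FreeGroup (Fin n) →* G}
    (h : ∀ j, f (circleGen n j) = g (circleGen n j)) : f = g := by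
  ext i
  rw [← circleGen_of_lt]
  exact h _

/-- The automorphism by which `σ_i` acts on the free group: in terms of the generators
`T_j = x_1 ⋯ x_j`, it replaces `T_{i+1}` by `T_{i+2} T_{i+1}⁻¹ T_i`. -/
def artinGen (n : ℕ) (i : Fin n) : MulAut (FreeGroup (Fin n)) :=
  MonoidHom.toMulEquiv
    (replaceGen i (circleGen n (i + 2) * (circleGen n (i + 1))⁻¹ * circleGen n i))
    (replaceGen i (circleGen n i * (circleGen n (i + 1))⁻¹ * circleGen n (i + 2)))
    (hom_ext_circleGen fun j => by
      simp only [MonoidHom.comp_apply, replaceGen_circleGen, MonoidHom.id_apply]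
      split_ifs with h
      · simp [replaceGen_circleGen, h, mul_assoc]
      · simp [replaceGen_circleGen, h])
    (hom_ext_circleGen fun j => by
      simp only [MonoidHom.comp_apply, replaceGen_circleGen, MonoidHom.id_apply]
      split_ifs with h
      · simp [replaceGen_circleGen, h, mul_assoc]
      · simp [replaceGen_circleGen, h])

theorem artinGen_circleGen (n : ℕ) (i : Fin n) (j : ℕ) :
    artinGen n i (circleGen n j) = if j = i.val + 1 then
      circleGen n (i + 2) * (circleGen n (i + 1))⁻¹ * circleGen n i else circleGen n j :=
  replaceGen_circleGen _ _ _

theorem mulAut_ext_circleGen {n : ℕ} {f g : MulAut (FreeGroup (Fin n))}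
    (h : ∀ j, f (circleGen n j) = g (circleGen n j)) : f = g :=
  MulEquiv.toMonoidHom_injective (hom_ext_circleGen h)

theorem artinGen_braid (n : ℕ) (i j : Fin n) (hij : i.val + 1 = j.val) :
    artinGen n i * artinGen n j * artinGen n i = artinGen n j * artinGen n i * artinGen n j := by
  apply mulAut_ext_circleGen
  intro l
  have a1 : i.val ≠ i.val + 1 + 1 := by omega
  simp only [MulAut.mul_apply, artinGen_circleGen, ← hij]
  by_cases h1 : l = i.val + 1
  · subst h1
    simp [artinGen_circleGen, ← hij, mul_assoc, a1]
  · by_cases h2 : l = i.val + 2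
    · subst h2
      simp [artinGen_circleGen, ← hij, mul_assoc, a1]
    · simp [artinGen_circleGen, ← hij, h1, h2]

theorem artinGen_comm (n : ℕ) (i j : Fin n) (hij : i.val + 2 ≤ j.val) :
    artinGen n i * artinGen n j = artinGen n j * artinGen n i := by
  apply mulAut_ext_circleGen
  intro l
  have a1 : i.val ≠ j.val := by omega
  have a3 : i.val ≠ j.val + 1 := by omega
  have a4 : i.val + 2 ≠ j.val + 1 := by omega
  have a5 : j.val ≠ i.val + 1 := by omega
  have a6 : j.val + 1 ≠ i.val := by omega
  have a7 : j.val ≠ i.val := by omega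
  simp only [MulAut.mul_apply, artinGen_circleGen]
  by_cases h1 : l = i.val + 1
  · subst h1
    simp [artinGen_circleGen, a1, a3, a4]
  · by_cases h2 : l = j.val + 1
    · subst h2
      simp [artinGen_circleGen, a5, a6, a7]
    · simp [artinGen_circleGen, h1, h2]

/-- The action of `B_{n+1}` on the free group on `n` generators, which is the quotient of Artin's
action on the free group on `x_1, …, x_{n+1}` by the relation `x_1 ⋯ x_{n+1} = 1`. -/
def artinAction (n : ℕ) : BraidGroup (n + 1) →* MulAut (FreeGroup (Fin n)) :=
  braidLift (artinGen n) (artinGen_braid n) (artinGen_comm n)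

theorem artinAction_sigma (n : ℕ) (i : Fin n) :
    artinAction n (sigma (n + 1) i) = artinGen n i := by
  have h : i.val < n + 1 - 1 := i.isLt
  rw [sigma, dif_pos h, artinAction, braidLift_of]
  rfl

/-- The automorphism `f` is arbitrary so that the induction can absorb the first letter of the word
into it. The action of a word thereby becomes a computation with sequences in a group. -/
theorem artinAction_word (n : ℕ) (w : List ℕ) (hw : ∀ i ∈ w, i < n)
    (f : MulAut (FreeGroup (Fin n))) (j : ℕ) :
    f (artinAction n (w.map (sigma (n + 1))).prod (circleGen n j)) =
      w.foldl tupleMove (fun l => f (circleGen n l)) j := by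
  induction w generalizing f with
  | nil => simp
  | cons i w ih =>
    have hi : i < n := hw i (by simp)
    have e := artinAction_sigma n ⟨i, hi⟩
    rw [List.map_cons, List.prod_cons, map_mul, MulAut.mul_apply, List.foldl_cons, e]
    have := ih (fun a ha => hw a (by simp [ha])) (f * artinGen n ⟨i, hi⟩)
    rw [MulAut.mul_apply] at this
    rw [this]
    refine congrArg (fun t => List.foldl tupleMove t w j) (funext fun l => ?_)
    simp only [MulAut.mul_apply, artinGen_circleGen, tupleMove, Function.update_apply]
    split_ifs <;> simp

/-! ## Cabled words acting on sequences -/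

theorem cableWord_succ (p q : ℕ) :
    cableWord (p + 1) q = (List.range q).map (fun b => p + b) ++ cableWord p q := by
  simp [cableWord, List.range_succ]

theorem cableWord_zero_left (q : ℕ) : cableWord 0 q = [] := rfl

theorem cableWord_zero_right (p : ℕ) : cableWord p 0 = [] := by
  simp [cableWord]

theorem lt_of_mem_cableWord {p q i : ℕ} (h : i ∈ cableWord p q) : i + 1 < p + q := by
  simp only [cableWord, List.mem_flatMap, List.mem_reverse, List.mem_range, List.mem_map] at h
  obtain ⟨a, ha, b, hb, rfl⟩ := h
  omega

section TupleMove

variable {G : Type*} [Group G]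

theorem foldl_tupleMove_row (t : ℕ → G) (a q j : ℕ) :
    ((List.range q).map (fun b => a + b)).foldl tupleMove t j =
      if a < j ∧ j ≤ a + q then t (j + 1) * (t (a + 1))⁻¹ * t a else t j := by
  induction q generalizing j with
  | zero => rw [if_neg (by omega)]; rfl
  | succ q ih =>
    rw [List.range_succ, List.map_append, List.foldl_append]
    simp only [List.map_cons, List.map_nil, List.foldl_cons, List.foldl_nil]
    rw [tupleMove, Function.update_apply]
    simp only [ih]
    by_cases h : j = a + q + 1
    · subst h
      rw [if_pos rfl, if_neg (by omega), if_neg (by omega)]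
      by_cases hq : q = 0
      · subst hq
        rw [if_neg (by omega), if_pos (by omega)]
        rfl
      · rw [if_pos (by omega), if_pos (by omega)]
        group
    · rw [if_neg h]
      by_cases hj : a < j ∧ j ≤ a + q
      · rw [if_pos hj, if_pos (by omega)]
      · rw [if_neg hj, if_neg (by omega)]

theorem foldl_tupleMove_row_reverse (t : ℕ → G) (a q j : ℕ) :
    ((List.range q).map (fun b => a + b)).reverse.foldl tupleMove t j =
      if a < j ∧ j ≤ a + q then t (a + q + 1) * (t (a + q))⁻¹ * t (j - 1) else t j := by
  induction q generalizing t j with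
  | zero => rw [if_neg (by omega)]; rfl
  | succ q ih =>
    rw [List.range_succ, List.map_append, List.reverse_append]
    simp only [List.map_cons, List.map_nil, List.reverse_cons, List.reverse_nil, List.nil_append,
      List.cons_append, List.foldl_cons]
    rw [ih]
    simp only [tupleMove, Function.update_apply]
    by_cases h : j = a + q + 1
    · subst h
      rw [if_neg (by omega), if_pos rfl, if_pos (by omega)]
      rfl
    · by_cases hj : a < j ∧ j ≤ a + q
      · rw [if_pos hj, if_pos trivial, if_neg (by omega), if_neg (by omega), if_pos (by omega)]
        simp [mul_assoc, add_assoc]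
      · rw [if_neg hj, if_neg h, if_neg (by omega)]

/-- On the quotients `t (j + 1) * (t j)⁻¹` a move is a Hurwitz move. A cable crossing brings the `q`
quotients of the second block to the front unchanged and conjugates the `p` quotients of the first
block by the product `t (p + q) * (t p)⁻¹` of the second. -/
theorem foldl_tupleMove_cableWord (t : ℕ → G) (p q j : ℕ) :
    (cableWord p q).foldl tupleMove t j =
      if j ≤ q then t (p + j) * (t p)⁻¹ * t 0
      else if j ≤ q + p then t (p + q) * (t p)⁻¹ * t (j - q) else t j := by
  induction p generalizing t with
  | zero =>
    rw [cableWord_zero_left, List.foldl_nil]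
    split_ifs with h1 h2
    · simp
    · omega
    · rfl
  | succ p ih =>
    rw [cableWord_succ, List.foldl_append, ih]
    simp only [foldl_tupleMove_row]
    by_cases h1 : j ≤ q
    · rw [if_pos h1, if_pos h1]
      by_cases h0 : j = 0
      · subst h0
        simp
      · rw [if_pos (by omega), if_neg (by omega), if_neg (by omega),
          show p + 1 + j = p + j + 1 by omega]
        group
    · rw [if_neg h1, if_neg h1]
      by_cases h2 : j ≤ q + p
      · rw [if_pos h2, if_pos (show j ≤ q + (p + 1) by omega)]
        by_cases hq : q = 0
        · subst hq
          rw [if_neg (by omega), if_neg (by omega), if_neg (by omega)]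
          simp
        · rw [if_pos (by omega), if_neg (by omega), if_neg (by omega),
            show p + 1 + q = p + q + 1 by omega]
          group
      · rw [if_neg h2, if_neg (by omega)]
        by_cases h3 : j ≤ q + (p + 1)
        · rw [if_pos h3, show j - q = p + 1 by omega, show j = p + 1 + q by omega]
          group
        · rw [if_neg h3]

theorem foldl_tupleMove_cableWord_reverse (t : ℕ → G) (p q j : ℕ) :
    (cableWord p q).reverse.foldl tupleMove t j =
      if j ≤ p then t (q + j) * (t q)⁻¹ * t 0
      else if j ≤ p + q then t (p + q) * (t q)⁻¹ * t (j - p) else t j := by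
  induction p generalizing j with
  | zero =>
    rw [cableWord_zero_left, List.reverse_nil, List.foldl_nil]
    split_ifs with h1 h2
    · obtain rfl : j = 0 := by omega
      simp
    · simp
    · rfl
  | succ p ih =>
    rw [cableWord_succ, List.reverse_append, List.foldl_append, foldl_tupleMove_row_reverse]
    simp only [ih]
    by_cases h1 : j ≤ p
    · rw [if_neg (by omega), if_pos h1, if_pos (by omega)]
    · by_cases hq : q = 0
      · subst hq
        rw [if_neg (by omega), if_neg h1]
        by_cases h2 : j = p + 1
        · subst h2
          simp
        · rw [if_neg (by omega), if_neg (by omega), if_neg (by omega)]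
      · by_cases h2 : j ≤ p + q
        · rw [if_pos (by omega), if_neg (by omega), if_neg (by omega), if_neg (by omega),
            if_pos (by omega), show p + q - p = q by omega, show p + 1 + q = p + q + 1 by omega]
          by_cases h3 : j = p + 1
          · subst h3
            rw [if_pos (by omega), if_pos (by omega), show q + (p + 1) = p + q + 1 by omega]
            simp [mul_assoc, add_comm]
          · rw [if_neg (by omega), if_pos (by omega), if_neg (by omega), if_pos (by omega),
              show j - 1 - p = j - (p + 1) by omega]
            group
        · rw [if_neg (by omega), if_neg h1, if_neg h2, if_neg (by omega)]
          by_cases h3 : j ≤ p + 1 + q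
          · rw [if_pos h3, show j - (p + 1) = q by omega, show j = p + 1 + q by omega]
            group
          · rw [if_neg h3]

end TupleMove

/-- The two cable crossings are composed; the values `T_0 = T_{n+1} = 1` cancel everything except
conjugation by `T_p`. -/
theorem artinAction_cableBraid {n p q : ℕ} (h : p + q = n + 1) (j : ℕ) :
    artinAction n (cableBraid (n + 1) p q) (circleGen n j) =
      if j ≤ p then (circleGen n p)⁻¹ * circleGen n j * circleGen n p
      else circleGen n p * circleGen n j * (circleGen n p)⁻¹ := by
  have hw : ∀ i ∈ cableWord p q ++ (cableWord p q).reverse, i < n := by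
    intro i hi
    have : i ∈ cableWord p q := by simpa using hi
    have := lt_of_mem_cableWord this
    omega
  have key := artinAction_word n _ hw 1 j
  simp only [MulAut.one_apply] at key
  rw [cableBraid, key, List.foldl_append]
  simp only [foldl_tupleMove_cableWord_reverse, foldl_tupleMove_cableWord, h, circleGen_zero,
    circleGen_of_gt (Nat.lt_succ_self n)]
  by_cases h1 : j ≤ p
  · rw [if_pos h1, if_pos h1]
    by_cases h0 : j = 0
    · subst h0
      simp [h, circleGen_of_gt (Nat.lt_succ_self n)]
    · rw [if_neg (by omega), if_pos (by omega), show q + j - q = j by omega]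
      simp
  · rw [if_neg h1, if_neg h1]
    by_cases h2 : j ≤ n + 1
    · rw [if_pos h2]
      by_cases hp : p = 0
      · subst hp
        have e : q = n + 1 := by omega
        subst e
        simp [circleGen_of_gt (Nat.lt_succ_self n), h2]
      · rw [if_neg (by omega), if_pos (by omega), if_pos (by omega), if_pos (by omega),
          show p + (j - p) = j by omega, show n + 1 - q = p by omega]
        simp [mul_assoc]
    · rw [if_neg h2, if_neg (by omega), if_neg (by omega), circleGen_of_gt (by omega)]
      simp

/-! ## The first letter of an element of a free group -/

/-- `StartsWith a w` says that the reduced word of `w` starts with a power of the letter `a`. -/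
inductive StartsWith {ι : Type} : ι → FreeGroup ι → Prop
  | single (a : ι) (j : ℤ) (hj : j ≠ 0) : StartsWith a (FreeGroup.of a ^ j)
  | cons (a b : ι) (j : ℤ) (w : FreeGroup ι) (hj : j ≠ 0) (hab : a ≠ b) (hw : StartsWith b w) :
      StartsWith a (FreeGroup.of a ^ j * w)

theorem of_zpow_ne_one {ι : Type} (a : ι) {j : ℤ} (hj : j ≠ 0) : FreeGroup.of a ^ j ≠ 1 := by
  rw [Ne, IsMulTorsionFree.zpow_eq_one_iff_left hj]
  exact FreeGroup.of_ne_one a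

/-- The normal form in a free product of infinite cyclic groups makes the first letter well defined.
-/
theorem StartsWith.exists_word {ι : Type} {a : ι} {w : FreeGroup ι} (h : StartsWith a w) :
    ∃ v : Monoid.CoprodI.Word (fun _ : ι => FreeGroup Unit),
      v.prod = freeGroupEquivCoprodI w ∧ v.fstIdx = some a := by
  classical
  have hof : ∀ (a : ι) (j : ℤ), freeGroupEquivCoprodI (FreeGroup.of a ^ j) =
      Monoid.CoprodI.of (M := fun _ : ι => FreeGroup Unit) (i := a) (FreeGroup.of () ^ j) := by
    intro a j
    simp
  induction h with
  | single a j hj =>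
    refine ⟨Monoid.CoprodI.Word.cons (i := a) (FreeGroup.of () ^ j)
      Monoid.CoprodI.Word.empty (by
      rintro ⟨⟩) (of_zpow_ne_one _ hj), ?_, ?_⟩
    · rw [Monoid.CoprodI.Word.prod_cons, hof, Monoid.CoprodI.Word.prod_empty, mul_one]
    · exact Monoid.CoprodI.Word.fstIdx_cons ..
  | cons a b j w hj hab hw ih =>
    obtain ⟨v, hv, hb⟩ := ih
    refine ⟨Monoid.CoprodI.Word.cons (FreeGroup.of () ^ j) v (by
      rw [hb]; simpa using hab.symm) (of_zpow_ne_one _ hj), ?_, ?_⟩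
    · rw [Monoid.CoprodI.Word.prod_cons, map_mul, hof, hv]
    · exact Monoid.CoprodI.Word.fstIdx_cons ..

theorem StartsWith.eq {ι : Type} {a b : ι} {w : FreeGroup ι} (ha : StartsWith a w)
    (hb : StartsWith b w) : a = b := by
  classical
  obtain ⟨u, hu, hua⟩ := ha.exists_word
  obtain ⟨v, hv, hvb⟩ := hb.exists_word
  have : u = v := Monoid.CoprodI.Word.equiv.symm.injective (hu.trans hv.symm)
  subst this
  exact Option.some.inj (hua.symm.trans hvb)

/-! ## Ping-pong -/

/-- `-1` for the letters before `m` and `1` for the letters after `m`. -/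
def sideSign {n : ℕ} (m a : Fin n) : ℤ := if a < m then -1 else 1

/-- Induction on the blocks of the reduced word. Between two consecutive blocks of letters other
than `m`, the conjugating powers of `m` and a possible block `m ^ i` merge into one power. If it
vanishes, the two letters that meet are distinct: either no block `m ^ i` was there, or they lie on
opposite sides of `m`. Hence the first letter survives. The second clause, for words that start with
`m`, leaves this power open so that the induction can go through. -/
theorem map_startsWith {n : ℕ} {m : Fin n} {f : MulAut (FreeGroup (Fin n))} {k : ℤ} (hk : k ≠ 0)
    (hm : f (FreeGroup.of m) = FreeGroup.of m)
    (hf : ∀ a, a ≠ m → f (FreeGroup.of a) = FreeGroup.of m ^ (sideSign m a * k) *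
      FreeGroup.of a * (FreeGroup.of m ^ (sideSign m a * k))⁻¹)
    {a : Fin n} {w : FreeGroup (Fin n)} (hw : StartsWith a w) :
    (a ≠ m → ∃ v, StartsWith a v ∧ f w = FreeGroup.of m ^ (sideSign m a * k) * v) ∧
    (a = m → ∃ j : ℤ, j ≠ 0 ∧ (f w = FreeGroup.of m ^ j ∨ ∃ b v, b ≠ m ∧ StartsWith b v ∧
      f w = FreeGroup.of m ^ (j + sideSign m b * k) * v)) := by
  have hpow : ∀ a, a ≠ m → ∀ j : ℤ, f (FreeGroup.of a ^ j) = FreeGroup.of m ^ (sideSign m a * k) *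
      (FreeGroup.of a ^ j * FreeGroup.of m ^ (-(sideSign m a * k))) := by
    intro a ha j
    rw [map_zpow, hf a ha, conj_zpow, zpow_neg, mul_assoc]
  have hsk : ∀ a, sideSign m a * k ≠ 0 := by
    intro a
    rw [sideSign]
    split_ifs <;> simpa
  induction hw with
  | single a j hj =>
    refine ⟨fun ha => ⟨_, ?_, hpow a ha j⟩, fun ha => ⟨j, hj, Or.inl ?_⟩⟩
    · exact .cons a m j _ hj ha (.single _ _ (by simpa using hsk a))
    · rw [ha, map_zpow, hm]
  | cons a b j w hj hab hw ih =>
    refine ⟨fun ha => ?_, fun ha => ⟨j, hj, Or.inr ?_⟩⟩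
    · refine ⟨FreeGroup.of a ^ j * (FreeGroup.of m ^ (-(sideSign m a * k)) * f w), ?_, ?_⟩
      · by_cases hb : b = m
        · obtain ⟨i, hi, h | ⟨c, v, hc, hv, h⟩⟩ := ih.2 hb
          · rw [h, ← zpow_add]
            by_cases h0 : -(sideSign m a * k) + i = 0
            · rw [h0, zpow_zero, mul_one]
              exact .single a j hj
            · exact .cons a m j _ hj ha (.single _ _ h0)
          · rw [h, ← mul_assoc (FreeGroup.of m ^ _) (FreeGroup.of m ^ _), ← zpow_add]
            by_cases h0 : -(sideSign m a * k) + (i + sideSign m c * k) = 0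
            · rw [h0, zpow_zero, one_mul]
              -- If `a = c`, the two conjugating powers cancel and the vanishing exponent is `i`,
              -- which is nonzero.
              refine .cons a c j _ hj ?_ hv
              rintro rfl
              apply hi
              linarith
            · exact .cons a m j _ hj ha (.cons _ _ _ _ h0 hc.symm hv)
        · obtain ⟨v, hv, h⟩ := ih.1 hb
          rw [h, ← mul_assoc (FreeGroup.of m ^ _) (FreeGroup.of m ^ _), ← zpow_add]
          by_cases h0 : -(sideSign m a * k) + sideSign m b * k = 0
          · rw [h0, zpow_zero, one_mul]
            exact .cons a b j _ hj hab hv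
          · exact .cons a m j _ hj ha (.cons _ _ _ _ h0 (Ne.symm hb) hv)
      · rw [map_mul, hpow a ha]
        simp only [mul_assoc]
    · subst ha
      obtain ⟨v, hv, h⟩ := ih.1 hab.symm
      refine ⟨b, v, hab.symm, hv, ?_⟩
      rw [map_mul, map_zpow, hm, h, zpow_add, mul_assoc]

theorem zpow_apply_eq_conj {n : ℕ} {m a : Fin n} {f : MulAut (FreeGroup (Fin n))} {e : ℤ}
    (hm : f (FreeGroup.of m) = FreeGroup.of m)
    (ha : f (FreeGroup.of a) = FreeGroup.of m ^ e * FreeGroup.of a * (FreeGroup.of m ^ e)⁻¹)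
    (k : ℤ) : (f ^ k) (FreeGroup.of a) =
      FreeGroup.of m ^ (e * k) * FreeGroup.of a * (FreeGroup.of m ^ (e * k))⁻¹ := by
  have step : ∀ k : ℤ, f (FreeGroup.of m ^ (e * k) * FreeGroup.of a *
      (FreeGroup.of m ^ (e * k))⁻¹) = FreeGroup.of m ^ (e * (k + 1)) * FreeGroup.of a *
        (FreeGroup.of m ^ (e * (k + 1)))⁻¹ := by
    intro k
    rw [map_mul, map_mul, map_inv, map_zpow, hm, ha, mul_add, mul_one, zpow_add]
    group
  induction k with
  | zero => simp
  | succ k ih => rw [add_comm, zpow_add, zpow_one, MulAut.mul_apply, ih, step, add_comm]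
  | pred k ih =>
    apply f.injective
    rw [step, ← MulAut.mul_apply, ← zpow_one_add, add_sub_cancel, sub_add_cancel, ih]

/-- Ping-pong: by `map_startsWith`, every nontrivial power of `f m` sends words that start with
another letter to words that start with `m`. -/
theorem lift_injective_of_conj_letters {n : ℕ} (hn : 2 ≤ n)
    (f : Fin n → MulAut (FreeGroup (Fin n)))
    (hm : ∀ m, f m (FreeGroup.of m) = FreeGroup.of m)
    (hf : ∀ m a, a ≠ m → f m (FreeGroup.of a) = FreeGroup.of m ^ sideSign m a *
      FreeGroup.of a * (FreeGroup.of m ^ sideSign m a)⁻¹) :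
    Function.Injective (FreeGroup.lift f) := by
  have e : FreeGroup.lift f = (Monoid.CoprodI.lift fun i => FreeGroup.lift fun _ => f i).comp
      (@freeGroupEquivCoprodI (Fin n)).toMonoidHom := by
    ext i
    simp
  rw [e, MonoidHom.coe_comp]
  refine Function.Injective.comp ?_ (MulEquiv.injective freeGroupEquivCoprodI)
  have : Nontrivial (Fin n) := Fin.nontrivial_iff_two_le.2 hn
  refine Monoid.CoprodI.lift_injective_of_ping_pong _ ?_ (fun a => {w | StartsWith a w})
    ?_ ?_ ?_
  -- The ping-pong lemma asks for three factors or for a factor with at least three elements; here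
  -- the factors are infinite cyclic.
  · right
    refine ⟨⟨0, by omega⟩, ?_⟩
    rw [FreeGroup.freeGroupUnitEquivInt.cardinal_eq, Cardinal.mk_denumerable]
    exact Cardinal.natCast_le_aleph0
  · exact fun a => ⟨_, .single a 1 one_ne_zero⟩
  · intro a b hab
    exact Set.disjoint_left.2 fun w ha hb => hab (StartsWith.eq ha hb)
  · intro m a hma
    refine FreeGroup.freeGroupUnitEquivInt.forall_congr_left.mpr ?_
    intro k hk
    have hk0 : k ≠ 0 := by
      rintro rfl
      apply hk
      simp [FreeGroup.freeGroupUnitEquivInt]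
    rintro _ ⟨w, hw, rfl⟩
    change StartsWith m (FreeGroup.lift (fun _ => f m) (FreeGroup.of () ^ k) w)
    rw [map_zpow, FreeGroup.lift_apply_of]
    have h1 : (f m ^ k) (FreeGroup.of m) = FreeGroup.of m := by
      have := zpow_apply_eq_conj (e := 0) (hm m) (by simpa using hm m) k
      simpa using this
    obtain ⟨v, hv, h⟩ := (map_startsWith hk0 h1
      (fun b hb => zpow_apply_eq_conj (hm m) (hf m b hb) k) hw).1 hma.symm
    rw [h]
    refine .cons _ _ _ _ ?_ hma hv
    rw [sideSign]
    split_ifs <;> simpa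

/-- The bound on `n` is needed for this argument: for `n = 1` the full twist acts trivially on the
free group of rank one. -/
theorem Theta_injective {n : ℕ} (hn : 2 ≤ n) : Function.Injective (Theta n) := by
  have key : Function.Injective (FreeGroup.lift fun m : Fin n =>
      artinAction n (cableBraid (n + 1) (m.val + 1) (n - m.val))) := by
    refine lift_injective_of_conj_letters hn _ (fun m => ?_) fun m a ha => ?_
    · rw [← circleGen_of_lt, artinAction_cableBraid (by omega), if_pos le_rfl]
      simp
    · rw [← circleGen_of_lt, ← circleGen_of_lt, artinAction_cableBraid (by omega), sideSign]
      have hne : a.val ≠ m.val := fun h => ha (Fin.ext h)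
      by_cases h : a < m
      · have h' : a.val < m.val := h
        rw [if_pos (by omega), if_pos h]
        simp
      · have h' : ¬ a.val < m.val := h
        rw [if_neg (by omega), if_neg h]
        simp
  -- The image of `y_{q+1}` has a first cable of `n - q` strands, so it conjugates by `T_{n-q}`,
  -- which is the letter `Fin.rev q`.
  have e : ((artinAction n).comp (PureBraid (n + 1)).subtype).comp (Theta n) =
      (FreeGroup.lift fun m : Fin n =>
        artinAction n (cableBraid (n + 1) (m.val + 1) (n - m.val))).comp
        (FreeGroup.map Fin.rev) := by
    ext1 q
    simp only [MonoidHom.comp_apply, Theta, FreeGroup.lift_apply_of, FreeGroup.map.of,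
      Subgroup.subtype_apply, Fin.val_rev]
    rw [show n - (q.val + 1) + 1 = n - q.val by omega, show n - (n - (q.val + 1)) = q.val + 1 by
      omega]
  have h : Function.Injective ((FreeGroup.lift fun m : Fin n =>
      artinAction n (cableBraid (n + 1) (m.val + 1) (n - m.val))).comp
        (FreeGroup.map Fin.rev)) :=
    key.comp (FreeGroup.map_injective Fin.rev_injective)
  rw [← e] at h
  exact fun x y hxy => h (congrArg (fun b => artinAction n b.1) hxy)

/-! ## Deletion of a strand of a cabled braid -/

/-- The position of a strand that enters the crossing `i` in position `p`. -/
def crossPos (p i : ℕ) : ℕ := if p = i then i + 1 else if p = i + 1 then i else p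

/-- The letters that are left of the crossing `i` when the strand in position `p` is deleted. -/
def deleteLetter (p i : ℕ) : List ℕ :=
  if p < i then [i - 1] else if p ≤ i + 1 then [] else [i]

/-- The final position of the strand of a positive word that starts in position `p`. -/
def wordPos (p : ℕ) (w : List ℕ) : ℕ := w.foldl crossPos p

/-- Deletion of the strand that starts in position `p` from a positive word. -/
def deleteWord : ℕ → List ℕ → List ℕ
  | _, [] => []
  | p, i :: w => deleteLetter p i ++ deleteWord (crossPos p i) w

/-- Deletion from a positive word is done on the list of its letters. For cables the resulting lists
agree on the nose, so no braid relation is needed. -/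
theorem deleteStrand_word (n : ℕ) (w : List ℕ) (hw : ∀ i ∈ w, i < n) (p : Fin (n + 1)) :
    deleteStrand n p (w.map (sigma (n + 1))).prod =
      ((deleteWord p w).map (sigma n)).prod := by
  induction w generalizing p with
  | nil => simp [deleteStrand, deleteWord]
  | cons i w ih =>
    have hi : i < n + 1 - 1 := hw i (by simp)
    have es : sigma (n + 1) i = PresentedGroup.of ⟨i, hi⟩ := by rw [sigma, dif_pos hi]
    rw [List.map_cons, List.prod_cons, deleteStrand_mul, ih fun a ha => hw a (by simp [ha]),
      deleteWord, List.map_append, List.prod_append, es, deleteStrand_of, braidPerm, braidLift_of,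
      adjSwap_inv, adjSwap_val]
    congr 1
    rw [deleteGen, deleteLetter]
    split_ifs <;> simp

theorem deleteWord_append (p : ℕ) (u v : List ℕ) :
    deleteWord p (u ++ v) = deleteWord p u ++ deleteWord (wordPos p u) v := by
  induction u generalizing p with
  | nil => rfl
  | cons i u ih => simp [deleteWord, ih, wordPos]

theorem wordPos_append (p : ℕ) (u v : List ℕ) :
    wordPos p (u ++ v) = wordPos (wordPos p u) v := List.foldl_append

theorem crossPos_crossPos (p i : ℕ) : crossPos (crossPos p i) i = p := by
  grind [crossPos]

theorem deleteLetter_crossPos (p i : ℕ) : deleteLetter (crossPos p i) i = deleteLetter p i := by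
  grind [crossPos, deleteLetter]

theorem deleteLetter_reverse (p i : ℕ) : (deleteLetter p i).reverse = deleteLetter p i := by
  rw [deleteLetter]
  split_ifs <;> rfl

theorem wordPos_reverse (p : ℕ) (w : List ℕ) : wordPos (wordPos p w) w.reverse = p := by
  induction w generalizing p with
  | nil => rfl
  | cons i w ih =>
    have : wordPos p (i :: w) = wordPos (crossPos p i) w := rfl
    rw [this, List.reverse_cons, wordPos_append, ih]
    exact crossPos_crossPos p i

/-- Reading a word backwards retraces the path of the deleted strand, so the return half of a cabled
twist needs no separate computation. -/
theorem deleteWord_reverse (p : ℕ) (w : List ℕ) :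
    deleteWord (wordPos p w) w.reverse = (deleteWord p w).reverse := by
  induction w generalizing p with
  | nil => rfl
  | cons i w ih =>
    have : wordPos p (i :: w) = wordPos (crossPos p i) w := rfl
    rw [this, List.reverse_cons, deleteWord_append, ih, wordPos_reverse]
    simp [deleteWord, deleteLetter_crossPos, deleteLetter_reverse]

theorem row_succ (a q : ℕ) : (List.range (q + 1)).map (fun b => a + b) =
    (List.range q).map (fun b => a + b) ++ [a + q] := by
  simp [List.range_succ]

theorem wordPos_row (p a q : ℕ) : wordPos p ((List.range q).map fun b => a + b) =
    if p = a then a + q else if a < p ∧ p ≤ a + q then p - 1 else p := by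
  induction q with
  | zero => grind [wordPos]
  | succ q ih =>
    rw [row_succ, wordPos_append, ih]
    simp only [wordPos, List.foldl_cons, List.foldl_nil, crossPos]
    grind

theorem deleteWord_row (p a q : ℕ) : deleteWord p ((List.range q).map fun b => a + b) =
    if p < a then (List.range q).map fun b => a - 1 + b else if p = a then []
    else if p ≤ a + q then (List.range (q - 1)).map fun b => a + b
    else (List.range q).map fun b => a + b := by
  induction q with
  | zero => simp [deleteWord]
  | succ q ih =>
    have hr := wordPos_row p a q
    rw [row_succ, deleteWord_append, ih]
    generalize wordPos p _ = r at hr ⊢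
    simp only [deleteWord, deleteLetter, List.append_nil]
    by_cases h1 : p < a
    · rw [if_neg (by omega), if_neg (by omega)] at hr
      rw [if_pos h1, if_pos h1, if_pos (by omega), row_succ, show a + q - 1 = a - 1 + q by omega]
    · rw [if_neg h1, if_neg h1]
      by_cases h2 : p = a
      · rw [if_pos h2] at hr
        simp [h2, hr]
      · rw [if_neg h2] at hr
        rw [if_neg h2, if_neg h2]
        by_cases h3 : p ≤ a + q
        · obtain ⟨q, rfl⟩ : ∃ r, q = r + 1 := ⟨q - 1, by omega⟩
          rw [if_pos (by omega)] at hr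
          rw [if_pos h3, if_pos (by omega), if_pos (by omega), Nat.add_sub_cancel,
            Nat.add_sub_cancel, row_succ, show a + (q + 1) - 1 = a + q by omega]
        · rw [if_neg (by omega)] at hr
          rw [if_neg h3, if_neg (by omega)]
          by_cases h4 : p ≤ a + (q + 1)
          · rw [if_pos (by omega), if_pos h4]
            simp
          · rw [if_neg (by omega), if_neg h4]

theorem deleteWord_cableWord_of_le (p q s : ℕ) (h : p + q ≤ s) : deleteWord s (cableWord p q) =
    cableWord p q := by
  induction p with
  | zero => rfl
  | succ p ih =>
    rw [cableWord_succ, deleteWord_append, deleteWord_row, wordPos_row, if_neg (by omega),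
      if_neg (by omega), if_neg (by omega), if_neg (by omega), if_neg (by omega), ih (by omega)]

/-- The row of the deleted strand disappears, the rows before it shift by one, and afterwards the
strand stays to the right of all remaining crossings. -/
theorem deleteWord_cableWord_left (p q s : ℕ) (h : s < p) : deleteWord s (cableWord p q) =
    cableWord (p - 1) q := by
  induction p with
  | zero => omega
  | succ p ih =>
    rw [cableWord_succ, deleteWord_append, deleteWord_row, wordPos_row, Nat.add_sub_cancel]
    by_cases hs : s = p
    · rw [if_neg (by omega), if_pos hs, if_pos hs, deleteWord_cableWord_of_le _ _ _ le_rfl,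
        List.nil_append]
    · rw [if_pos (by omega), if_neg hs, if_neg (by omega), ih (by omega)]
      obtain ⟨p, rfl⟩ : ∃ r, p = r + 1 := ⟨p - 1, by omega⟩
      rw [Nat.add_sub_cancel, cableWord_succ]

theorem deleteWord_cableWord_right (p q s : ℕ) (h : p ≤ s) (h' : s < p + q) :
    deleteWord s (cableWord p q) = cableWord p (q - 1) := by
  induction p generalizing s with
  | zero => rfl
  | succ p ih =>
    rw [cableWord_succ, deleteWord_append, deleteWord_row, wordPos_row, if_neg (by omega),
      if_neg (by omega), if_pos (by omega), if_neg (by omega), if_pos (by omega),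
      ih _ (by omega) (by omega), cableWord_succ]

theorem deleteStrand_cableBraid {n p q : ℕ} (h : p + q = n + 1) (s : Fin (n + 1)) :
    deleteStrand n s (cableBraid (n + 1) p q) =
      if s.val < p then cableBraid n (p - 1) q else cableBraid n p (q - 1) := by
  have hw : ∀ i ∈ cableWord p q ++ (cableWord p q).reverse, i < n := by
    intro i hi
    have : i ∈ cableWord p q := by simpa using hi
    have := lt_of_mem_cableWord this
    omega
  have hs := s.isLt
  rw [cableBraid, deleteStrand_word n _ hw, deleteWord_append, deleteWord_reverse]
  split_ifs with hp
  · rw [deleteWord_cableWord_left _ _ _ hp, cableBraid]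
  · rw [deleteWord_cableWord_right _ _ _ (by omega) (by omega), cableBraid]

theorem cableBraid_zero_left (n q : ℕ) : cableBraid n 0 q = 1 := by
  simp [cableBraid, cableWord_zero_left]

theorem cableBraid_zero_right (n p : ℕ) : cableBraid n p 0 = 1 := by
  simp [cableBraid, cableWord_zero_right]

theorem Theta_circleGen (n q : ℕ) :
    (Theta n (circleGen n q) : BraidGroup (n + 1)) = cableBraid (n + 1) (n + 1 - q) q := by
  rw [circleGen]
  split_ifs with h
  · rw [Theta, FreeGroup.lift_apply_of]
    change cableBraid (n + 1) (n - (q - 1)) (q - 1 + 1) = _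
    rw [show n - (q - 1) = n + 1 - q by omega, show q - 1 + 1 = q by omega]
  · rw [map_one, OneMemClass.coe_one]
    obtain h | h : q = 0 ∨ n < q := by omega
    · rw [h, cableBraid_zero_right]
    · rw [show n + 1 - q = 0 by omega, cableBraid_zero_left]

/-- The cabling homomorphisms commute with the faces. -/
theorem face_Theta (n : ℕ) (j : Fin (n + 2)) (w : FreeGroup (Fin (n + 1))) :
    face (n + 1) j (Theta (n + 1) w) = Theta n (circleFace n j w) := by
  suffices h : (face (n + 1) j).comp (Theta (n + 1)) = (Theta n).comp (circleFace n j) from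
    DFunLike.congr_fun h w
  ext1 q
  apply Subtype.ext
  have hq := q.isLt
  have hj := j.isLt
  simp only [MonoidHom.comp_apply, circleFace, FreeGroup.lift_apply_of]
  change deleteStrand (n + 1) j (Theta (n + 1) (FreeGroup.of q) : BraidGroup (n + 2)) = _
  rw [← circleGen_of_lt, Theta_circleGen, deleteStrand_cableBraid (by omega)]
  by_cases h : j.val + (q.val + 1) ≤ n + 1
  · rw [if_pos h, if_pos (by omega), Theta_circleGen]
    congr 1
    omega
  · rw [if_neg h, if_neg (by omega), Theta_circleGen]
    congr 1
    omega

/-! ## Deletion of two strands -/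

theorem deleteStrand_one (n : ℕ) (p : Fin (n + 1)) : deleteStrand n p 1 = 1 := by
  simp [deleteStrand]

theorem deleteStrand_sigma (n : ℕ) (p : Fin (n + 1)) (i : ℕ) (hi : i < n) :
    deleteStrand n p (sigma (n + 1) i) = if p.val < i then sigma n (i - 1)
      else if p.val ≤ i + 1 then 1 else sigma n i := by
  have hi' : i < n + 1 - 1 := hi
  rw [sigma, dif_pos hi', deleteStrand_of]
  rfl

/-- Two strands can be deleted in either order. -/
theorem deleteStrand_deleteStrand (n : ℕ) (b : BraidGroup (n + 2)) (p q : Fin (n + 2))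
    (p' q' : Fin (n + 1)) (hq : p.succAbove q' = q) (hp : q.succAbove p' = p) :
    deleteStrand n q' (deleteStrand (n + 1) p b) =
      deleteStrand n p' (deleteStrand (n + 1) q b) := by
  -- Once the claim holds for `x`, the claim for `x * y` is equivalent to the one for `y` at the
  -- positions to which `x` carries the strands. This serves both products and inverses.
  have hmul : ∀ x y : BraidGroup (n + 2),
      (∀ p q p' q', p.succAbove q' = q → q.succAbove p' = p →
        deleteStrand n q' (deleteStrand (n + 1) p x) =
          deleteStrand n p' (deleteStrand (n + 1) q x)) →
      ∀ p q p' q', p.succAbove q' = q → q.succAbove p' = p →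
        (deleteStrand n q' (deleteStrand (n + 1) p (x * y)) =
          deleteStrand n p' (deleteStrand (n + 1) q (x * y)) ↔
        deleteStrand n ((braidPerm (n + 1) (deleteStrand (n + 1) p x))⁻¹ q')
          (deleteStrand (n + 1) ((braidPerm (n + 2) x)⁻¹ p) y) =
        deleteStrand n ((braidPerm (n + 1) (deleteStrand (n + 1) q x))⁻¹ p')
          (deleteStrand (n + 1) ((braidPerm (n + 2) x)⁻¹ q) y)) := by
    intro x y hx p q p' q' hq hp
    rw [deleteStrand_mul (n + 1), deleteStrand_mul (n + 1), deleteStrand_mul, deleteStrand_mul,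
      hx p q p' q' hq hp, mul_right_inj]
  induction b using PresentedGroup.induction_on with
  | _ w =>
  induction w using FreeGroup.induction_on generalizing p q p' q' with
  | C1 => simp [deleteStrand_one]
  | of i =>
    have hdel : ∀ (p : Fin (n + 2)) (q : Fin (n + 1)),
        deleteStrand n q (deleteGen (n + 1) i p) =
          if p.val < i.val then
            if q.val < i.val - 1 then sigma n (i.val - 2) else if q.val ≤ i.val then 1
            else sigma n (i.val - 1)
          else if p.val ≤ i.val + 1 then 1
          else if q.val < i.val then sigma n (i.val - 1) else if q.val ≤ i.val + 1 then 1
          else sigma n i.val := by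
      intro p q
      have hi := i.isLt
      have hp := p.isLt
      rw [deleteGen]
      by_cases h1 : p.val < i.val
      · rw [if_pos h1, if_pos h1, deleteStrand_sigma _ _ _ (by omega),
          show i.val - 1 + 1 = i.val by omega]
        rfl
      · rw [if_neg h1, if_neg h1]
        by_cases h2 : p.val ≤ i.val + 1
        · rw [if_pos h2, if_pos h2, deleteStrand_one]
        · rw [if_neg h2, if_neg h2, deleteStrand_sigma _ _ _ (by omega)]
    have hv : ∀ (x : Fin (n + 2)) (y : Fin (n + 1)), (x.succAbove y).val =
        if y.val < x.val then y.val else y.val + 1 := by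
      intro x y
      rw [Fin.succAbove]
      simp only [Fin.lt_def, Fin.val_castSucc]
      split_ifs <;> simp
    have hq' := hv p q'
    have hp' := hv q p'
    rw [hq] at hq'
    rw [hp] at hp'
    change deleteStrand n q' (deleteStrand (n + 1) p (PresentedGroup.of i)) =
      deleteStrand n p' (deleteStrand (n + 1) q (PresentedGroup.of i))
    rw [deleteStrand_of, deleteStrand_of, hdel, hdel]
    clear hmul hdel hv hp hq
    split_ifs at * <;> first | rfl | (exfalso; omega)
  | inv_of i ih =>
    rw [map_inv]
    generalize PresentedGroup.mk (braidRels (n + 2)) (FreeGroup.of i) = x at ih ⊢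
    obtain ⟨r, rfl⟩ := (braidPerm (n + 2) x)⁻¹.surjective p
    obtain ⟨s, rfl⟩ := (braidPerm (n + 2) x)⁻¹.surjective q
    obtain ⟨r', rfl⟩ := (braidPerm (n + 1) (deleteStrand (n + 1) s x))⁻¹.surjective p'
    obtain ⟨s', rfl⟩ := (braidPerm (n + 1) (deleteStrand (n + 1) r x))⁻¹.surjective q'
    rw [← deleteStrand_perm, EmbeddingLike.apply_eq_iff_eq] at hq hp
    -- The claim for `x⁻¹` is the one for `x * x⁻¹ = 1` at the initial positions.
    rw [← hmul x x⁻¹ ih r s r' s' hq hp, mul_inv_cancel]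
    simp [deleteStrand_one]
  | mul x y hx hy =>
    rw [map_mul, hmul _ _ hx p q p' q' hq hp]
    apply hy
    · rw [← deleteStrand_perm, hq]
    · rw [← deleteStrand_perm, hp]

theorem face_zero_face_zero (n : ℕ) (b : PureBraid (n + 2)) :
    face n 0 (face (n + 1) 0 b) = face n 0 (face (n + 1) 1 b) := by
  apply Subtype.ext
  exact deleteStrand_deleteStrand n b.1 0 1 0 0 rfl rfl

/-! ## Supports in the kernel of a projection -/

section Support

variable {G : Type} [Group G]

/-- The action of a group on the free group on its elements by left translation of the letters. -/
def translateLetters : G →* MulAut (FreeGroup G) where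
  toFun g := FreeGroup.freeGroupCongr (Equiv.mulLeft g)
  map_one' := by
    ext x
    induction x using FreeGroup.induction_on <;> simp_all
  map_mul' g h := by
    apply MulEquiv.toMonoidHom_injective
    ext x
    simp [mul_assoc]

theorem translateLetters_of (g h : G) :
    translateLetters g (FreeGroup.of h) = FreeGroup.of (g * h) := by
  simp [translateLetters]

theorem exists_finset_mem_closure {ι : Type} [DecidableEq ι] (x : FreeGroup ι) :
    ∃ A : Finset ι, x ∈ Subgroup.closure (FreeGroup.of '' (A : Set ι)) := by
  induction x using FreeGroup.induction_on with
  | C1 => exact ⟨∅, one_mem _⟩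
  | of a => exact ⟨{a}, Subgroup.subset_closure ⟨a, by simp, rfl⟩⟩
  | inv_of a h => exact h.imp fun A hA => inv_mem hA
  | mul x y hx hy =>
    obtain ⟨A, hA⟩ := hx
    obtain ⟨B, hB⟩ := hy
    refine ⟨A ∪ B, mul_mem (Subgroup.closure_mono ?_ hA) (Subgroup.closure_mono ?_ hB)⟩ <;>
    exact Set.image_mono (by simp)

theorem eq_one_of_mem_closure_of_disjoint {ι : Type} {A B : Set ι} (h : Disjoint A B)
    {x : FreeGroup ι} (hA : x ∈ Subgroup.closure (FreeGroup.of '' A))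
    (hB : x ∈ Subgroup.closure (FreeGroup.of '' B)) : x = 1 := by
  classical
  let e : FreeGroup ι →* FreeGroup ι := FreeGroup.lift fun a => if a ∈ A then FreeGroup.of a else 1
  have h1 : Subgroup.closure (FreeGroup.of '' A) ≤ e.eqLocus (MonoidHom.id _) := by
    rw [Subgroup.closure_le]
    rintro _ ⟨a, ha, rfl⟩
    change e (FreeGroup.of a) = FreeGroup.of a
    simp [e, ha]
  have h2 : Subgroup.closure (FreeGroup.of '' B) ≤ e.ker := by
    rw [Subgroup.closure_le]
    rintro _ ⟨a, ha, rfl⟩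
    change e (FreeGroup.of a) = 1
    simp [e, Set.disjoint_right.1 h ha]
  exact (h1 hA).symm.trans (h2 hB)

theorem exists_mul_image_disjoint [Infinite G] (A : Finset G) :
    ∃ g : G, Disjoint (A : Set G) ((fun h => g * h) '' (A : Set G)) := by
  classical
  obtain ⟨g, hg⟩ := Infinite.exists_notMem_finset
    ((A ×ˢ A).image fun p : G × G => p.1 * p.2⁻¹)
  refine ⟨g, Set.disjoint_right.2 ?_⟩
  rintro _ ⟨h, hh, rfl⟩ hgh
  apply hg
  exact Finset.mem_image.2 ⟨(g * h, h), Finset.mk_mem_product hgh hh, by simp⟩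

/-- The inclusion of the free group on the first `n` letters. -/
def inclFree (n : ℕ) : FreeGroup (Fin n) →* FreeGroup (Fin (n + 1)) := FreeGroup.map Fin.castSucc

/-- The decomposition of the free group on `n + 1` letters as the semidirect product of the normal
closure of the last letter, which is free on the conjugates of that letter by elements of the free
group on the other letters, and of the latter group. -/
def splitLast (n : ℕ) : FreeGroup (Fin (n + 1)) →*
    FreeGroup (FreeGroup (Fin n)) ⋊[translateLetters] FreeGroup (Fin n) :=
  FreeGroup.lift (Fin.lastCases (SemidirectProduct.inl (FreeGroup.of 1))
    fun i => SemidirectProduct.inr (FreeGroup.of i))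

theorem splitLast_inclFree (n : ℕ) (g : FreeGroup (Fin n)) :
    splitLast n (inclFree n g) = SemidirectProduct.inr g := by
  suffices h : (splitLast n).comp (inclFree n) = SemidirectProduct.inr from DFunLike.congr_fun h g
  ext1 i
  simp [splitLast, inclFree]

theorem splitLast_injective (n : ℕ) : Function.Injective (splitLast n) := by
  let r : FreeGroup (FreeGroup (Fin n)) ⋊[translateLetters] FreeGroup (Fin n) →*
      FreeGroup (Fin (n + 1)) :=
    SemidirectProduct.lift
      (FreeGroup.lift fun g => inclFree n g * FreeGroup.of (Fin.last n) * (inclFree n g)⁻¹)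
      (inclFree n) (by
        intro g
        ext1 h
        simp [translateLetters_of, mul_assoc])
  have h : r.comp (splitLast n) = MonoidHom.id _ := by
    ext1 i
    refine Fin.lastCases ?_ (fun i => ?_) i <;> simp [splitLast, r, inclFree]
  exact Function.LeftInverse.injective (g := r) fun x => DFunLike.congr_fun h x

theorem splitLast_right (n : ℕ) (w : FreeGroup (Fin (n + 1))) :
    (splitLast n w).right = circleFace n 0 w := by
  suffices h : SemidirectProduct.rightHom.comp (splitLast n) = circleFace n 0 from
    DFunLike.congr_fun h w
  ext1 i
  refine Fin.lastCases ?_ (fun i => ?_) i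
  · simp [splitLast, circleFace, circleGen_of_gt]
  · have hi := i.isLt
    have h : i.val ≤ n := hi.le
    simp [splitLast, circleFace, circleGen_of_lt, h]

theorem circleFace_zero_inclFree (n : ℕ) (g : FreeGroup (Fin n)) :
    circleFace n 0 (inclFree n g) = g := by
  rw [← splitLast_right, splitLast_inclFree, SemidirectProduct.right_inr]

/-- A subgroup of the kernel of the projection that kills one letter is not finitely generated if
it contains a nontrivial normal subgroup of the whole free group. -/
theorem not_fg_of_le_ker {n : ℕ} (hn : 1 ≤ n) {H N : Subgroup (FreeGroup (Fin (n + 1)))}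
    (hH : H ≤ (circleFace n 0).ker) (hNH : N ≤ H) (hN : N.Normal) (hN1 : N ≠ ⊥) : ¬ H.FG := by
  classical
  have : Nonempty (Fin n) := ⟨⟨0, by omega⟩⟩
  rintro ⟨S, hS⟩
  choose A hA using fun w : FreeGroup (Fin (n + 1)) =>
    exists_finset_mem_closure (splitLast n w).left
  let B := S.biUnion A
  let C := Subgroup.closure (FreeGroup.of '' (B : Set (FreeGroup (Fin n))))
  -- The generators lie in the kernel, so only their left components matter; their finitely many
  -- letters form `B`.
  have hC : H ≤ (C.map SemidirectProduct.inl).comap (splitLast n) := by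
    have hSH : (S : Set (FreeGroup (Fin (n + 1)))) ⊆ H := hS ▸ Subgroup.subset_closure
    rw [← hS, Subgroup.closure_le]
    intro w hw
    refine ⟨(splitLast n w).left, Subgroup.closure_mono (Set.image_mono ?_) (hA w), ?_⟩
    · exact_mod_cast Finset.subset_biUnion_of_mem A hw
    · refine SemidirectProduct.ext rfl ?_
      rw [splitLast_right]
      exact (hH (hSH hw)).symm
  obtain ⟨w, hw, hw1⟩ := N.bot_or_exists_ne_one.resolve_left hN1
  obtain ⟨x, hx, hxw⟩ := hC (hNH hw)
  -- Conjugation by `g` stays in `N` but moves the support off `B`.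
  obtain ⟨g, hg⟩ := exists_mul_image_disjoint B
  obtain ⟨y, hy, hyw⟩ := hC (hNH (hN.conj_mem w hw (inclFree n g)))
  have hyx : y = translateLetters g x := by
    rw [map_mul, map_mul, map_inv, splitLast_inclFree, ← hxw, ← map_inv, ← SemidirectProduct.inl_aut] at hyw
    exact SemidirectProduct.inl_injective hyw
  have hgx : translateLetters g x ∈ Subgroup.closure
      (FreeGroup.of '' ((fun h => g * h) '' (B : Set (FreeGroup (Fin n))))) := by
    have h : C ≤ (Subgroup.closure (FreeGroup.of '' ((fun h => g * h) ''
        (B : Set (FreeGroup (Fin n)))))).comap (translateLetters g).toMonoidHom := by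
      rw [Subgroup.closure_le]
      rintro _ ⟨b, hb, rfl⟩
      exact Subgroup.subset_closure ⟨g * b, ⟨b, hb, rfl⟩, (translateLetters_of g b).symm⟩
    exact h hx
  have h1 : translateLetters g x = 1 :=
    eq_one_of_mem_closure_of_disjoint hg (hyx ▸ hy) hgx
  have hx1 : x = 1 := (translateLetters g).injective (by rw [h1, map_one])
  apply hw1
  apply splitLast_injective n
  rw [← hxw, hx1, map_one, map_one]

end Support

/-- A basis embeds in the countable group, and a finite one would generate it. -/
theorem isFreeOfCountablyInfiniteRank_of_not_fg {G : Type} [Group G] [IsFreeGroup G] [Countable G]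
    (h : ¬ Group.FG G) : IsFreeOfCountablyInfiniteRank G := by
  have b := IsFreeGroup.basis G
  have : Countable (IsFreeGroup.Generators G) := b.injective.countable
  have : Infinite (IsFreeGroup.Generators G) := by
    by_contra hfin
    rw [not_infinite_iff_finite] at hfin
    exact h (Group.fg_of_surjective (f := b.repr.symm.toMonoidHom) b.repr.symm.surjective)
  obtain ⟨e⟩ := nonempty_equiv_of_countable (α := IsFreeGroup.Generators G) (β := ℕ)
  exact ⟨b.reindex e⟩

/-! ## Faces of the free simplicial group on the circle -/

theorem circleFace_circleGen (n : ℕ) (j : Fin (n + 2)) (q : ℕ) :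
    circleFace n j (circleGen (n + 1) q) =
      if j.val + q ≤ n + 1 then circleGen n q else circleGen n (q - 1) := by
  have hj := j.isLt
  by_cases h : 1 ≤ q ∧ q ≤ n + 1
  · obtain ⟨q, rfl⟩ := Nat.exists_eq_add_of_le' h.1
    lift q to Fin (n + 1) using by omega
    rw [circleGen_of_lt, circleFace, FreeGroup.lift_apply_of]
    rfl
  · obtain rfl | h : q = 0 ∨ n + 1 < q := by omega
    · simp
    · rw [circleGen_of_gt h, map_one, if_neg (by omega), circleGen_of_gt (by omega)]

theorem circleFace_zero_circleGen (n q : ℕ) :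
    circleFace n 0 (circleGen (n + 1) q) = circleGen n q := by
  rw [circleFace_circleGen, Fin.val_zero, zero_add]
  split_ifs with h
  · rfl
  · rw [circleGen_of_gt (by omega), circleGen_of_gt (by omega)]

theorem circleFace_circleFace_zero (n : ℕ) (i : Fin (n + 2)) (w : FreeGroup (Fin (n + 2))) :
    circleFace n i (circleFace (n + 1) 0 w) = circleFace n 0 (circleFace (n + 1) i.succ w) := by
  suffices h : (circleFace n i).comp (circleFace (n + 1) 0) =
      (circleFace n 0).comp (circleFace (n + 1) i.succ) from DFunLike.congr_fun h w
  refine hom_ext_circleGen fun q => ?_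
  simp only [MonoidHom.comp_apply, circleFace_zero_circleGen]
  rw [circleFace_circleGen, circleFace_circleGen, Fin.val_succ]
  by_cases h : i.val + q ≤ n + 1
  · rw [if_pos h, if_pos (by omega), circleFace_zero_circleGen]
  · rw [if_neg h, if_neg (by omega), circleFace_zero_circleGen]

theorem circleBoundaries_le_circleCycles (n : ℕ) :
    circleBoundaries (n + 1) ≤ circleCycles (n + 1) := by
  rintro _ ⟨w, hw, rfl⟩
  refine Subgroup.mem_iInf.2 fun i => ?_
  have : circleFace (n + 1) i.succ w = 1 := Subgroup.mem_iInf.1 hw i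
  rw [MonoidHom.mem_ker, circleFace_circleFace_zero, this, map_one]

/-- The image of a normal subgroup is normal since `d_0` is surjective, with section `inclFree`. -/
theorem circleBoundaries_normal (n : ℕ) : (circleBoundaries n).Normal := by
  refine Subgroup.Normal.map (Subgroup.normal_iInf_normal fun j => inferInstance) _ fun g => ?_
  exact ⟨inclFree n g, circleFace_zero_inclFree n g⟩

/-! ## A nontrivial boundary -/

open scoped commutatorElement

/-- The iterated commutator `[…[[y_1, y_1⁻¹ y_2], y_2⁻¹ y_3], …, y_m⁻¹ y_{m+1}]`. -/
def iterComm {G : Type*} [Group G] (y : ℕ → G) : ℕ → G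
  | 0 => y 1
  | m + 1 => ⁅iterComm y m, (y (m + 1))⁻¹ * y (m + 2)⁆

theorem map_iterComm {G H : Type*} [Group G] [Group H] (f : G →* H) (y : ℕ → G) (m : ℕ) :
    f (iterComm y m) = iterComm (fun q => f (y q)) m := by
  induction m with
  | zero => rfl
  | succ m ih => rw [iterComm, iterComm, map_commutatorElement, ih, map_mul, map_inv]

theorem iterComm_eq_one {G : Type*} [Group G] {y : ℕ → G} {m : ℕ}
    (h : y 1 = 1 ∨ ∃ l < m, y (l + 1) = y (l + 2)) : iterComm y m = 1 := by
  induction m with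
  | zero => simpa [iterComm] using h
  | succ m ih =>
    rw [iterComm]
    by_cases hm : y (m + 1) = y (m + 2)
    · rw [hm, inv_mul_cancel, commutatorElement_one_right]
    · rw [ih, commutatorElement_one_left]
      refine h.imp_right ?_
      rintro ⟨l, hl, e⟩
      refine ⟨l, lt_of_le_of_ne (by omega) ?_, e⟩
      rintro rfl
      exact hm e

/-- The affine permutation `v ↦ a v + b` of the rational numbers. -/
def affinePerm (a : ℚˣ) (b : ℚ) : Equiv.Perm ℚ where
  toFun v := a * v + b
  invFun v := a⁻¹ * (v - b)
  left_inv v := by simp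
  right_inv v := by simp

theorem affinePerm_mul (a a' : ℚˣ) (b b' : ℚ) :
    affinePerm a b * affinePerm a' b' = affinePerm (a * a') (a * b' + b) := by
  ext v
  simp [affinePerm]
  ring

theorem affinePerm_one : affinePerm 1 0 = 1 := by
  ext v
  simp [affinePerm]

theorem affinePerm_inv (a : ℚˣ) (b : ℚ) :
    (affinePerm a b)⁻¹ = affinePerm a⁻¹ (-(a⁻¹ * b)) := by
  rw [inv_eq_iff_mul_eq_one, affinePerm_mul, ← affinePerm_one]
  congr 1 <;> simp

/-- The commutator of the translation by `c` with an affine map of linear part `r` is the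
translation by `(1 - r) * c`. -/
theorem iterComm_affinePerm {y : ℕ → Equiv.Perm ℚ} {a : ℕ → ℚˣ} {b : ℕ → ℚ} {m : ℕ}
    (hy : ∀ q, y q = affinePerm (a q) (b q)) (h1 : a 1 = 1) (hb : b 1 ≠ 0)
    (h : ∀ i < m, a (i + 1) ≠ a (i + 2)) :
    ∃ c : ℚ, c ≠ 0 ∧ iterComm y m = affinePerm 1 c := by
  induction m with
  | zero => exact ⟨b 1, hb, by rw [iterComm, hy, h1]⟩
  | succ m ih =>
    obtain ⟨c, hc, e⟩ := ih fun i hi => h i (by omega)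
    refine ⟨(1 - ((a (m + 1))⁻¹ * a (m + 2) : ℚˣ)) * c, mul_ne_zero ?_ hc, ?_⟩
    · rw [sub_ne_zero, Ne, eq_comm, Units.val_eq_one, inv_mul_eq_one]
      exact h m (by omega)
    · rw [iterComm, e, hy, hy, commutatorElement_def]
      simp only [affinePerm_inv, affinePerm_mul]
      congr 1
      · simp
      · push_cast
        field_simp
        ring

/-- Send `y_q` to `v ↦ 2 ^ (q - 1) * v + 1`. Then `y_1` is a translation and consecutive linear
parts differ, also in the last step, where `y_{k+1} = 1` is compared with `2 ^ (k - 1) ≠ 1`. -/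
theorem iterComm_circleGen_ne_one {k : ℕ} (hk : 2 ≤ k) : iterComm (circleGen k) k ≠ 1 := by
  let two : ℚˣ := Units.mk0 2 two_ne_zero
  let f : FreeGroup (Fin k) →* Equiv.Perm ℚ :=
    FreeGroup.lift fun i => affinePerm (two ^ i.val) 1
  let a : ℕ → ℚˣ := fun q => if 1 ≤ q ∧ q ≤ k then two ^ (q - 1) else 1
  let b : ℕ → ℚ := fun q => if 1 ≤ q ∧ q ≤ k then 1 else 0
  have hf : ∀ q, f (circleGen k q) = affinePerm (a q) (b q) := by
    intro q
    simp only [circleGen, a, b]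
    split_ifs with h
    · simp [f]
    · rw [map_one, affinePerm_one]
  have htwo : ∀ {i j : ℕ}, two ^ i = two ^ j → i = j := by
    intro i j h
    have : (2 : ℚ) ^ i = 2 ^ j := by simpa [two] using congrArg Units.val h
    exact pow_right_injective₀ (by norm_num) (by norm_num) this
  obtain ⟨c, hc, e⟩ := iterComm_affinePerm (m := k) hf (by simp [a]) (by simp [b]; omega) (by
    intro i hi
    by_cases h : i + 2 ≤ k
    · simp only [a]
      rw [if_pos (by omega), if_pos (by omega)]
      intro h'
      have := htwo h'
      omega
    · simp only [a]
      rw [if_pos (by omega), if_neg (by omega), ← pow_zero two]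
      intro h'
      have := htwo h'
      omega)
  intro h
  rw [← map_iterComm, h, map_one] at e
  apply hc
  have := DFunLike.congr_fun e 0
  simpa [affinePerm] using this.symm

/-- The iterated commutator in degree `k + 1` has an entry killed by each `d_j` with `j ≥ 1`: the
last face kills `y_1`, and any other one identifies two consecutive generators. Its image under
`d_0` is the element above. -/
theorem circleBoundaries_ne_bot {k : ℕ} (hk : 2 ≤ k) : circleBoundaries k ≠ ⊥ := by
  intro h
  apply iterComm_circleGen_ne_one hk
  rw [← Subgroup.mem_bot, ← h]
  refine ⟨iterComm (circleGen (k + 1)) k, Subgroup.mem_iInf.2 fun j => ?_, ?_⟩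
  · have hj := j.isLt
    rw [MonoidHom.mem_ker, map_iterComm]
    apply iterComm_eq_one
    simp only [circleFace_circleGen, Fin.val_succ]
    by_cases h : j.val = k
    · left
      rw [if_neg (by omega)]
      simp
    · right
      -- The face `d_{j+1}` identifies `y_{k-j}` and `y_{k-j+1}`.
      refine ⟨k - j.val - 1, by omega, ?_⟩
      rw [if_pos (by omega), if_neg (by omega)]
      congr 1
  · rw [map_iterComm]
    simp only [circleFace_zero_circleGen]

/-! ## Cycles and boundaries as subgroups of pure braid groups -/

/-- A face of `Theta (k + 1) w` is `Theta k` of a face of `w`, so injectivity in the lower degree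
`k` is what counts. -/
theorem comap_Theta_Brunnian {k : ℕ} (hk : 2 ≤ k) :
    (Brunnian (k + 1)).comap (Theta (k + 1)) = circleCycles (k + 1) := by
  ext w
  change Theta (k + 1) w ∈ Brunnian (k + 1) ↔ w ∈ circleCyclesSucc k
  simp only [Brunnian, circleCyclesSucc, Subgroup.mem_iInf, MonoidHom.mem_ker, face_Theta,
    map_eq_one_iff _ (Theta_injective hk)]

theorem comap_Theta_QBrunnian {k : ℕ} (hk : 2 ≤ k) :
    (QBrunnian (k + 1)).comap (Theta (k + 1)) = ⨅ j : Fin (k + 1), (circleFace k j.succ).ker := by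
  ext w
  change Theta (k + 1) w ∈ QBrunnian (k + 1) ↔ _
  simp only [QBrunnian, Subgroup.mem_iInf, MonoidHom.mem_ker, face_Theta,
    map_eq_one_iff _ (Theta_injective hk)]

theorem map_Theta_circleBoundaries {k : ℕ} (hk : 2 ≤ k) :
    (circleBoundaries k).map (Theta k) =
      ((Theta (k + 1)).range ⊓ QBrunnian (k + 1)).map (face (k + 1) 0) := by
  rw [← Subgroup.map_comap_eq, comap_Theta_QBrunnian hk, circleBoundaries, Subgroup.map_map,
    Subgroup.map_map]
  congr 1
  ext1 q
  exact (face_Theta k 0 _).symm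

/-- If `Theta w = d_0 b` with `b` quasi-Brunnian, then `Theta (d_0 w) = d_0 d_0 b = d_0 d_1 b = 1`.
-/
theorem comap_Theta_map_face_le {k : ℕ} (hk : 2 ≤ k) :
    ((QBrunnian (k + 2)).map (face (k + 2) 0)).comap (Theta (k + 1)) ≤
      (circleFace k 0).ker := by
  rintro w ⟨b, hb, hw⟩
  apply Theta_injective hk
  have : face (k + 2) 1 b = 1 := Subgroup.mem_iInf.1 hb 0
  rw [← face_Theta, ← hw, face_zero_face_zero, this, map_one, map_one]

theorem isFreeOfCountablyInfiniteRank_map_Theta {k : ℕ} (hk : 2 ≤ k)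
    {H : Subgroup (FreeGroup (Fin (k + 1)))} (hH : H ≤ (circleFace k 0).ker)
    (hB : circleBoundaries (k + 1) ≤ H) :
    IsFreeOfCountablyInfiniteRank (H.map (Theta (k + 1))) := by
  have hfg := not_fg_of_le_ker (by omega) hH hB (circleBoundaries_normal _)
    (circleBoundaries_ne_bot (by omega))
  have : Countable (FreeGroup (Fin (k + 1))) := Quotient.countable
  obtain ⟨b⟩ := isFreeOfCountablyInfiniteRank_of_not_fg (G := H)
    (by rwa [Group.fg_iff_subgroup_fg])
  exact ⟨b.map (H.equivMapOfInjective _ (Theta_injective (by omega)))⟩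

end BraidCabling

theorem mainTheorem7 (k : ℕ) (hk : 3 ≤ k) :
    BraidCabling.IsFreeOfCountablyInfiniteRank
      ↥((BraidCabling.Theta k).range ⊓ BraidCabling.Brunnian k) ∧
    BraidCabling.IsFreeOfCountablyInfiniteRank
      ↥((BraidCabling.Theta k).range ⊓
        (BraidCabling.QBrunnian (k + 1)).map (BraidCabling.face (k + 1) 0)) ∧
    BraidCabling.IsFreeOfCountablyInfiniteRank
      ↥(((BraidCabling.Theta (k + 1)).range ⊓ BraidCabling.QBrunnian (k + 1)).map
        (BraidCabling.face (k + 1) 0)) ∧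
    Function.Injective (BraidCabling.Theta k) ∧
    (BraidCabling.circleCycles k).map (BraidCabling.Theta k) =
      (BraidCabling.Theta k).range ⊓ BraidCabling.Brunnian k ∧
    (BraidCabling.circleBoundaries k).map (BraidCabling.Theta k) =
      ((BraidCabling.Theta (k + 1)).range ⊓ BraidCabling.QBrunnian (k + 1)).map
        (BraidCabling.face (k + 1) 0) := by
  obtain ⟨k, rfl⟩ : ∃ m, k = m + 1 := ⟨k - 1, by omega⟩
  -- This is where `3 ≤ k` in the original indexing enters: the faces land one degree lower, and
  -- `Theta` has to be injective there.
  have hk2 : 2 ≤ k := by omega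
  have hcyc : (BraidCabling.circleCycles (k + 1)).map (BraidCabling.Theta (k + 1)) =
      (BraidCabling.Theta (k + 1)).range ⊓ BraidCabling.Brunnian (k + 1) := by
    rw [← BraidCabling.comap_Theta_Brunnian hk2, Subgroup.map_comap_eq]
  have hbdy := BraidCabling.map_Theta_circleBoundaries (k := k + 1) (by omega)
  have hle : BraidCabling.circleCycles (k + 1) ≤ (BraidCabling.circleFace k 0).ker :=
    iInf_le (fun j => (BraidCabling.circleFace k j).ker) 0
  have hbc := BraidCabling.circleBoundaries_le_circleCycles k
  refine ⟨?_, ?_, ?_, BraidCabling.Theta_injective (by omega), hcyc, hbdy⟩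
  · rw [← hcyc]
    exact BraidCabling.isFreeOfCountablyInfiniteRank_map_Theta hk2 hle hbc
  · rw [← Subgroup.map_comap_eq]
    refine BraidCabling.isFreeOfCountablyInfiniteRank_map_Theta hk2
      (BraidCabling.comap_Theta_map_face_le hk2) ?_
    rw [← Subgroup.map_le_iff_le_comap, hbdy]
    exact Subgroup.map_mono inf_le_right
  · rw [← hbdy]
    exact BraidCabling.isFreeOfCountablyInfiniteRank_map_Theta hk2 (hbc.trans hle) le_rfl
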